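/- Let $\mathbb F_q$ be a finite field, let $\theta$ be a fixed non-trivial homomorphism from the additive group of $\mathbb F_q$ to $\mathbb C^\times$, and let $n\ge 0$. Let $U=U(n,\mathbb F_q)$ be the group of upper triangular unipotent $n\times n$ matrices, $\mathfrak u$ the space of strictly upper triangular matrices, and $\mathfrak u^*$ its dual space. Write $e_{ij}$ ($1\le i<j\le n$) for the matrix units in $\mathfrak u$ and $\varepsilon_{ij}$ for the dual basis of $\mathfrak u^*$. The group $U$ acts on $\mathfrak u^*$ on the left by $(g*\lambda)(X)=\lambda(Xg)$ and on the right by $(\lambda*g)(X)=\lambda(gX)$. The coadjoint cluster of $\lambda\in\mathfrak u^*$ is $\Psi(\lambda)=\{g*\lambda*g' : g,g'\in U\}$; it is called primary if it equals $a\cdot\Psi(\varepsilon_{ij})$ for some $i<j$ and some $a\in\mathbb F_q\setminus\{0\}$. For $\lambda\in\mathfrak u^*$ let $v(\lambda)$ be the function $g\mapsto\theta(\lambda(g-I))$ on $U$. The cluster module $V(\lambda)$ is the linear span of $\{v(g*\lambda): g\in U\}$ in the space of complex-valued functions on $U$; it is a subrepresentation of the regular representation $(g*v)(g')=v(g'g)$.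 Its character $\chi(\lambda)$ is called a cluster character, and a primary cluster character if $\Psi(\lambda)$ is primary. An element $\tau\in\mathfrak u^*$ is called a coadjoint template if the set of positions $(i,j)$, $i<j$, with $\tau(e_{ij})\ne0$ contains at most one position in each row and at most one in each column. Then: 1. For every coadjoint template $\tau\in\mathfrak u^*$, $$\chi(\tau)=\prod_{1\le i<j\le n}\chi\bigl(\tau(e_{ij})\cdot\varepsilon_{ij}\bigr).$$ 2. Every cluster character is a tensor product of finitely many primary cluster characters: for every $\lambda\in\mathfrak u^*$ there are $m\ge0$ and $\mu_1,\dots,\mu_m\in\mathfrak u^*$ such that every $\Psi(\mu_k)$ is primary and $\chi(\lambda)=\prod_{k=1}^m\chi(\mu_k)$ is the character of $V(\mu_1)\otimes\cdots\otimes V(\mu_m)$ (for $m=0$, the trivial character). 3. Every primary cluster character is irreducible: if $\Psi(\lambda)$ is primary, then $V(\lambda)$ is an irreducible representation of $U$. -/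

import Mathlib

open scoped TensorProduct

noncomputable section

namespace ClusterRep

section Matrices

/-- The space `𝔲(n, K)` of upper triangular nilpotent (that is, strictly upper triangular)
`n × n` matrices over `K`. -/
def NilMat (n : ℕ) (K : Type*) [Field K] : Submodule K (Matrix (Fin n) (Fin n) K) where
  carrier := {X | ∀ i j, j ≤ i → X i j = 0}
  zero_mem' := by intro i j _; rfl
  add_mem' := by
    intro X Y hX hY i j hij
    simp [hX i j hij, hY i j hij]
  smul_mem' := by
    intro c X hX i j hij
    simp [hX i j hij]

variable {n : ℕ} {K : Type*} [Field K]

theorem mul_mem_nilMat_left {A X : Matrix (Fin n) (Fin n) K} (hA : A.IsUpperTriangular)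
    (hX : X ∈ NilMat n K) : A * X ∈ NilMat n K := by
  intro i j hij
  rw [Matrix.mul_apply]
  refine Finset.sum_eq_zero fun k _ => ?_
  rcases lt_or_ge k i with h | h
  · have : A i k = 0 := hA h
    simp [this]
  · simp [hX k j (hij.trans h)]

theorem mul_mem_nilMat_right {A X : Matrix (Fin n) (Fin n) K} (hA : A.IsUpperTriangular)
    (hX : X ∈ NilMat n K) : X * A ∈ NilMat n K := by
  intro i j hij
  rw [Matrix.mul_apply]
  refine Finset.sum_eq_zero fun k _ => ?_
  rcases lt_or_ge j k with h | h
  · have : A k j = 0 := hA h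
    simp [this]
  · simp [hX i k (h.trans hij)]

theorem isUpperTriangular_of_sub_one_mem {A : Matrix (Fin n) (Fin n) K}
    (hA : A - 1 ∈ NilMat n K) : A.IsUpperTriangular := by
  intro i j hij
  have hij' : j < i := hij
  have h := hA i j hij'.le
  rwa [Matrix.sub_apply, Matrix.one_apply_ne hij'.ne', sub_zero] at h

end Matrices

/-- The group `U(n, K)` of upper triangular unipotent matrices, that is, of the matrices `I + X`
with `X` strictly upper triangular, under matrix multiplication. -/
def UniGroup (n : ℕ) (K : Type*) [Field K] : Subgroup (Matrix.GeneralLinearGroup (Fin n) K) where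
  carrier := {g | (g : Matrix (Fin n) (Fin n) K) - 1 ∈ NilMat n K}
  one_mem' := by simp
  mul_mem' := by
    intro g h hg hh
    have e : ((g * h : Matrix.GeneralLinearGroup (Fin n) K) : Matrix (Fin n) (Fin n) K) - 1
        = g * ((h : Matrix (Fin n) (Fin n) K) - 1) + ((g : Matrix (Fin n) (Fin n) K) - 1) := by
      rw [Units.val_mul]; noncomm_ring
    simp only [Set.mem_ofPred_eq]
    rw [e]
    exact add_mem (mul_mem_nilMat_left (isUpperTriangular_of_sub_one_mem hg) hh) hg
  inv_mem' := by
    intro g hg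
    have hU := isUpperTriangular_of_sub_one_mem hg
    have hinv : ((g⁻¹ : Matrix.GeneralLinearGroup (Fin n) K) :
        Matrix (Fin n) (Fin n) K).IsUpperTriangular := by
      rw [Matrix.coe_units_inv]
      have : Invertible (g : Matrix (Fin n) (Fin n) K) := g.invertible
      exact Matrix.blockTriangular_inv_of_blockTriangular hU
    have e : ((g⁻¹ : Matrix.GeneralLinearGroup (Fin n) K) : Matrix (Fin n) (Fin n) K) - 1
        = -(((g⁻¹ : Matrix.GeneralLinearGroup (Fin n) K) : Matrix (Fin n) (Fin n) K)
            * ((g : Matrix (Fin n) (Fin n) K) - 1)) := by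
      rw [mul_sub, Units.inv_mul, mul_one, neg_sub]
    simp only [Set.mem_ofPred_eq]
    rw [e]
    exact neg_mem (mul_mem_nilMat_left hinv hg)

/-- The dual space `𝔲*(n, K)` of `𝔲(n, K)`. -/
abbrev DualNil (n : ℕ) (K : Type*) [Field K] : Type _ := Module.Dual K (NilMat n K)

section Actions

variable {n : ℕ} {K : Type*} [Field K]

/-- The underlying matrix of an element of `U(n, K)`. -/
def toMat (g : UniGroup n K) : Matrix (Fin n) (Fin n) K :=
  ((g : Matrix.GeneralLinearGroup (Fin n) K) : Matrix (Fin n) (Fin n) K)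

theorem toMat_isUpperTriangular (g : UniGroup n K) : (toMat g).IsUpperTriangular :=
  isUpperTriangular_of_sub_one_mem g.2

theorem toMat_mul (g h : UniGroup n K) : toMat (g * h) = toMat g * toMat h := rfl

/-- The matrix `g - I`, as an element of `𝔲(n, K)`. -/
def subOne (g : UniGroup n K) : NilMat n K := ⟨toMat g - 1, g.2⟩

/-- The linear map `X ↦ g · X` of `𝔲(n, K)`. -/
def mulLeftMap (g : UniGroup n K) : NilMat n K →ₗ[K] NilMat n K where
  toFun X := ⟨toMat g * X, mul_mem_nilMat_left (toMat_isUpperTriangular g) X.2⟩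
  map_add' X Y := Subtype.ext (by simp [mul_add])
  map_smul' c X := Subtype.ext (by simp)

/-- The linear map `X ↦ X · g` of `𝔲(n, K)`. -/
def mulRightMap (g : UniGroup n K) : NilMat n K →ₗ[K] NilMat n K where
  toFun X := ⟨X * toMat g, mul_mem_nilMat_right (toMat_isUpperTriangular g) X.2⟩
  map_add' X Y := Subtype.ext (by simp [add_mul])
  map_smul' c X := Subtype.ext (by simp)

/-- The left action of `U(n, K)` on `𝔲*(n, K)`: `(g * lam)(X) = lam(X · g)`. -/
def leftAct (g : UniGroup n K) (lam : DualNil n K) : DualNil n K := lam ∘ₗ mulRightMap g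

/-- The right action of `U(n, K)` on `𝔲*(n, K)`: `(lam * g)(X) = lam(g · X)`. -/
def rightAct (lam : DualNil n K) (g : UniGroup n K) : DualNil n K := lam ∘ₗ mulLeftMap g

theorem leftAct_leftAct (g h : UniGroup n K) (lam : DualNil n K) :
    leftAct g (leftAct h lam) = leftAct (g * h) lam := by
  ext X
  exact congrArg lam (Subtype.ext (by simp [mulRightMap, toMat_mul, mul_assoc]))

/-- The orbit of `lam` under the left action of `U(n, K)`. -/
def leftOrbit (lam : DualNil n K) : Set (DualNil n K) :=
  {mu | ∃ g : UniGroup n K, mu = leftAct g lam}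

/-- The coadjoint cluster `Ψ(lam) = {g * lam * g' : g, g' ∈ U(n, K)}`. -/
def coadjointCluster (lam : DualNil n K) : Set (DualNil n K) :=
  {mu | ∃ g g' : UniGroup n K, mu = rightAct (leftAct g lam) g'}

variable (n) in
/-- The positions `(i, j)` with `i < j`. -/
abbrev Pos : Type := {p : Fin n × Fin n // p.1 < p.2}

variable (K) in
/-- The elementary matrix `e_{ij}`, where `p = (i, j)` and `i < j`. -/
def elemMat (p : Pos n) : NilMat n K :=
  ⟨Matrix.single p.1.1 p.1.2 1, by
    intro i j hij
    refine Matrix.single_apply_of_ne _ _ _ _ _ ?_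
    rintro ⟨h1, h2⟩
    have := p.2
    rw [h1, h2] at this
    exact absurd this (not_lt.mpr hij)⟩

variable (K) in
/-- The dual basis element `ε_{ij}`, where `p = (i, j)` and `i < j`: it sends a matrix to its
`(i, j)` entry. -/
def dualElem (p : Pos n) : DualNil n K where
  toFun X := (X : Matrix (Fin n) (Fin n) K) p.1.1 p.1.2
  map_add' _ _ := rfl
  map_smul' _ _ := rfl

/-- The support of `lam`: the set of the positions `(i, j)` with `lam(e_{ij}) ≠ 0`. -/
def supp (lam : DualNil n K) : Set (Pos n) := {p | lam (elemMat K p) ≠ 0}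

/-- Coadjoint templates: the support contains at most one position in each row and at most one
position in each column. -/
def IsCoadjointTemplate (lam : DualNil n K) : Prop :=
  (∀ p ∈ supp lam, ∀ p' ∈ supp lam, p.1.1 = p'.1.1 → p = p') ∧
  (∀ p ∈ supp lam, ∀ p' ∈ supp lam, p.1.2 = p'.1.2 → p = p')

/-- A coadjoint cluster is primary if it is a multiple of the coadjoint cluster of some `ε_{ij}`
by a non-zero scalar. -/
def IsPrimaryCluster (Psi : Set (DualNil n K)) : Prop :=
  ∃ (p : Pos n) (a : K), a ≠ 0 ∧ Psi = (fun mu => a • mu) '' coadjointCluster (dualElem K p)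

end Actions

section Characters

variable {n : ℕ} {F : Type*} [Field F]

variable (n F) in
/-- The regular representation of `U(n, F)` on the space of complex-valued functions on `U(n, F)`:
`(g * v)(g') = v(g' g)`. -/
def regularRep : Representation ℂ (UniGroup n F) (UniGroup n F → ℂ) where
  toFun g := LinearMap.funLeft ℂ ℂ (fun g' => g' * g)
  map_one' := by ext v g'; simp [LinearMap.funLeft]
  map_mul' g h := by ext v g'; simp [LinearMap.funLeft, mul_assoc]

/-- The Fourier basis function `v(lam) : g ↦ θ(lam(g - I))`. -/
def fourier (θ : AddChar F ℂ) (lam : DualNil n F) : UniGroup n F → ℂ :=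
  fun g => θ (lam (subOne g))

theorem regularRep_fourier (θ : AddChar F ℂ) (lam : DualNil n F) (g : UniGroup n F) :
    regularRep n F g (fourier θ lam) = fourier θ lam g • fourier θ (leftAct g lam) := by
  funext g'
  have e : subOne (g' * g) = subOne g + mulRightMap g (subOne g') :=
    Subtype.ext (by
      change toMat (g' * g) - 1 = (toMat g - 1) + (toMat g' - 1) * toMat g
      rw [toMat_mul]; noncomm_ring)
  change θ (lam (subOne (g' * g))) = θ (lam (subOne g)) * θ (lam (mulRightMap g (subOne g')))
  rw [e, map_add, AddChar.map_add_eq_mul]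

/-- The cluster module `V(lam)`: the subrepresentation of the regular representation spanned by
the functions `v(mu)`, where `mu` runs through the orbit of `lam` under the left action. -/
def clusterModule (θ : AddChar F ℂ) (lam : DualNil n F) : Subrepresentation (regularRep n F) where
  toSubmodule := Submodule.span ℂ (fourier θ '' leftOrbit lam)
  apply_mem_toSubmodule g := by
    intro v hv
    induction hv using Submodule.span_induction with
    | mem x hx =>
      obtain ⟨mu, ⟨h, rfl⟩, rfl⟩ := hx
      rw [regularRep_fourier]
      refine Submodule.smul_mem _ _ (Submodule.subset_span ⟨_, ⟨g * h, ?_⟩, rfl⟩)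
      exact leftAct_leftAct g h lam
    | zero => rw [map_zero]; exact Submodule.zero_mem _
    | add x y _ _ hx hy => rw [map_add]; exact Submodule.add_mem _ hx hy
    | smul c x _ hx => rw [map_smul]; exact Submodule.smul_mem _ c hx

/-- The representation of `U(n, F)` on the cluster module `V(lam)`. -/
abbrev clusterRep (θ : AddChar F ℂ) (lam : DualNil n F) :
    Representation ℂ (UniGroup n F) (clusterModule θ lam).toSubmodule :=
  (clusterModule θ lam).toRepresentation

/-- The cluster character `χ(lam)`: the trace of `U(n, F)` on `V(lam)`. -/
def clusterCharacter (θ : AddChar F ℂ) (lam : DualNil n F) : UniGroup n F → ℂ :=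
  (clusterRep θ lam).character

end Characters

/-- The tensor product of a finite family of representations of a group. -/
def tensorRep {G ι : Type*} [Group G] {V : ι → Type*} [∀ k, AddCommGroup (V k)]
    [∀ k, Module ℂ (V k)] (ρ : ∀ k, Representation ℂ G (V k)) :
    Representation ℂ G (⨂[ℂ] k, V k) where
  toFun g := PiTensorProduct.map fun k => ρ k g
  map_one' := by simp [PiTensorProduct.map_one]
  map_mul' g h := by simp [PiTensorProduct.map_mul]

end ClusterRep

end

/-!
The functions `v(mu)` are the characters of the additive group `𝔲`, transported to `U` along
`g ↦ g - I`, and are therefore linearly independent. The group permutes the lines they span, so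
`clusterCharacter_apply` expresses `χ(lam)(g)` as the sum of `θ(mu(g - I))` over the points `mu` of
the left orbit of `lam` that `g` fixes.

The right action commutes with the left one, and does not change the value of `mu` at `g - I` when
`g` fixes `mu` (`rightAct_subOne`). Hence `χ(lam)` only depends on the coadjoint cluster of `lam`.
Regarding elements of `𝔲*` as strictly upper triangular matrices, the left action adds multiples of
columns to columns further left, and the right action adds multiples of rows to rows further down,
both truncated to the part above the diagonal. Elimination with these operations finds a template in
every cluster (`exists_template`).

For a template, the entries lie in different columns, so one group element can act on all of them
in independently prescribed ways; and they lie in different rows, which the left action preserves,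
so the left orbit is the direct sum of the left orbits of the entries (`exists_leftAct_eq`,
`eq_of_sum_eq`). The character formula then factors (`clusterCharacter_template`).

For the irreducibility of a primary cluster module, the elements `I + X` with `X` in the row `i` fix
every point of the left orbit of `a ε_{ij}`, and act on the lines spanned by its functions `v(mu)`
through pairwise distinct characters. Up to the right action this holds for every `lam` in the
cluster (`exists_separating`). An invariant subspace is therefore spanned by some of the `v(mu)`,
and transitivity of the group on the left orbit leaves no choice but zero and everything.
-/

open scoped TensorProduct

noncomputable section

namespace ClusterRep

/-! ### Coordinates on the group and on the dual space -/

section Coordinates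

variable {n : ℕ} {K : Type*} [Field K]

theorem det_one_add_nilMat (X : NilMat n K) :
    (1 + (X : Matrix (Fin n) (Fin n) K)).det = 1 := by
  have hX : (1 + (X : Matrix (Fin n) (Fin n) K)).IsUpperTriangular :=
    isUpperTriangular_of_sub_one_mem (by simp)
  rw [Matrix.det_of_isUpperTriangular hX]
  exact Finset.prod_eq_one fun i _ => by simp [X.2 i i le_rfl]

/-- The element `I + X` of `U(n, K)`. -/
def ofNil (X : NilMat n K) : UniGroup n K :=
  ⟨Matrix.GeneralLinearGroup.mkOfDetNeZero (1 + (X : Matrix (Fin n) (Fin n) K))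
      (by rw [det_one_add_nilMat]; exact one_ne_zero), by
    change 1 + (X : Matrix (Fin n) (Fin n) K) - 1 ∈ NilMat n K
    simp⟩

theorem toMat_ofNil (X : NilMat n K) : toMat (ofNil X) = 1 + (X : Matrix (Fin n) (Fin n) K) := rfl

theorem subOne_ofNil (X : NilMat n K) : subOne (ofNil X) = X :=
  Subtype.ext (by simp [subOne, toMat_ofNil])

theorem subOne_surjective : Function.Surjective (subOne : UniGroup n K → NilMat n K) :=
  fun X => ⟨ofNil X, subOne_ofNil X⟩

theorem toMat_eq_one_add (g : UniGroup n K) :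
    toMat g = 1 + (subOne g : Matrix (Fin n) (Fin n) K) := by simp [subOne]

/-- The `(i, j)` coordinate `lam(e_{ij})` of `lam`, extended by zero to the positions `j ≤ i`, so
that elements of the dual space can be handled as strictly upper triangular matrices. -/
def coeff (lam : DualNil n K) (i j : Fin n) : K :=
  if h : i < j then lam (elemMat K ⟨(i, j), h⟩) else 0

theorem coeff_of_lt (lam : DualNil n K) {i j : Fin n} (h : i < j) :
    coeff lam i j = lam (elemMat K ⟨(i, j), h⟩) := dif_pos h

theorem coeff_of_le (lam : DualNil n K) {i j : Fin n} (h : j ≤ i) : coeff lam i j = 0 :=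
  dif_neg (not_lt.mpr h)

theorem coeff_sum {ι : Type*} (s : Finset ι) (f : ι → DualNil n K) (i j : Fin n) :
    coeff (∑ k ∈ s, f k) i j = ∑ k ∈ s, coeff (f k) i j := by
  by_cases h : i < j
  · simp [coeff_of_lt _ h]
  · simp [coeff_of_le _ (not_lt.mp h)]

theorem apply_eq_sum_coeff (lam : DualNil n K) (X : NilMat n K) :
    lam X = ∑ i, ∑ j, (X : Matrix (Fin n) (Fin n) K) i j * coeff lam i j := by
  have hX : X = ∑ p : Pos n, (X : Matrix (Fin n) (Fin n) K) p.1.1 p.1.2 • elemMat K p := by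
    refine Subtype.ext ?_
    ext i j
    simp only [AddSubmonoidClass.coe_finsetSum, SetLike.val_smul, Matrix.sum_apply,
      Matrix.smul_apply, elemMat, Matrix.single_apply, smul_eq_mul, mul_ite, mul_one, mul_zero]
    by_cases h : i < j
    · rw [Finset.sum_eq_single ⟨(i, j), h⟩]
      · simp
      · intro q _ hq
        refine if_neg fun hh => hq (Subtype.ext (Prod.ext hh.1 hh.2))
      · simp
    · rw [X.2 i j (not_lt.mp h)]
      refine (Finset.sum_eq_zero fun q _ => if_neg fun hh => h ?_).symm
      rw [← hh.1, ← hh.2]; exact q.2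
  conv_lhs => rw [hX]
  rw [map_sum, ← Fintype.sum_prod_type']
  refine Finset.sum_of_injOn Subtype.val Subtype.val_injective.injOn (by simp) ?_ ?_
  · rintro ⟨i, j⟩ _ h
    rw [X.2 i j (not_lt.mp fun hij => h ⟨⟨(i, j), hij⟩, by simp, rfl⟩), zero_mul]
  · intro p _
    rw [map_smul, coeff_of_lt _ p.2, smul_eq_mul]

theorem ext_coeff {lam mu : DualNil n K} (h : ∀ i j, i < j → coeff lam i j = coeff mu i j) :
    lam = mu := by
  refine LinearMap.ext fun X => ?_
  rw [apply_eq_sum_coeff, apply_eq_sum_coeff]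
  refine Finset.sum_congr rfl fun i _ => Finset.sum_congr rfl fun j _ => ?_
  rcases lt_or_ge i j with hij | hij
  · rw [h i j hij]
  · rw [coeff_of_le _ hij, coeff_of_le _ hij]

theorem coeff_leftAct (g : UniGroup n K) (lam : DualNil n K) {i l : Fin n} (h : i < l) :
    coeff (leftAct g lam) i l = ∑ m, toMat g l m * coeff lam i m := by
  rw [coeff_of_lt _ h]
  change lam (mulRightMap g (elemMat K ⟨(i, l), h⟩)) = _
  rw [apply_eq_sum_coeff, Finset.sum_eq_single i]
  · simp [mulRightMap, elemMat]
  · intro k _ hk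
    refine Finset.sum_eq_zero fun m _ => ?_
    simp [mulRightMap, elemMat, hk]
  · simp

theorem coeff_rightAct (g : UniGroup n K) (lam : DualNil n K) {i l : Fin n} (h : i < l) :
    coeff (rightAct lam g) i l = ∑ k, toMat g k i * coeff lam k l := by
  rw [coeff_of_lt _ h]
  change lam (mulLeftMap g (elemMat K ⟨(i, l), h⟩)) = _
  rw [apply_eq_sum_coeff]
  refine Finset.sum_congr rfl fun k _ => ?_
  rw [Finset.sum_eq_single l]
  · simp [mulLeftMap, elemMat]
  · intro m _ hm
    simp [mulLeftMap, elemMat, hm]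
  · simp

theorem coeff_smul_dualElem (a : K) (p : Pos n) (i j : Fin n) :
    coeff (a • dualElem K p) i j = if i = p.1.1 ∧ j = p.1.2 then a else 0 := by
  by_cases h : i < j
  · rw [coeff_of_lt _ h]
    change a * Matrix.single i j 1 p.1.1 p.1.2 = _
    rw [Matrix.single_apply, mul_ite, mul_one, mul_zero]
  · rw [coeff_of_le _ (not_lt.mp h), if_neg]
    rintro ⟨rfl, rfl⟩
    exact h p.2

theorem sum_smul_dualElem (lam : DualNil n K) :
    ∑ p : Pos n, lam (elemMat K p) • dualElem K p = lam := by
  refine ext_coeff fun i j h => ?_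
  rw [coeff_sum, Finset.sum_eq_single ⟨(i, j), h⟩]
  · rw [coeff_smul_dualElem, if_pos ⟨rfl, rfl⟩, coeff_of_lt _ h]
  · intro q _ hq
    rw [coeff_smul_dualElem]
    exact if_neg fun hh => hq (Subtype.ext (Prod.ext hh.1.symm hh.2.symm))
  · simp

theorem leftAct_sum {ι : Type*} (g : UniGroup n K) (s : Finset ι) (f : ι → DualNil n K) :
    leftAct g (∑ k ∈ s, f k) = ∑ k ∈ s, leftAct g (f k) :=
  LinearMap.ext fun X => by simp [leftAct]

theorem leftAct_one (lam : DualNil n K) : leftAct 1 lam = lam :=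
  LinearMap.ext fun X => congrArg lam (Subtype.ext (by simp [mulRightMap, toMat]))

theorem rightAct_one (lam : DualNil n K) : rightAct lam 1 = lam :=
  LinearMap.ext fun X => congrArg lam (Subtype.ext (by simp [mulLeftMap, toMat]))

theorem rightAct_rightAct (g h : UniGroup n K) (lam : DualNil n K) :
    rightAct (rightAct lam g) h = rightAct lam (g * h) :=
  LinearMap.ext fun X => congrArg lam (Subtype.ext (by simp [mulLeftMap, toMat_mul, mul_assoc]))

theorem leftAct_rightAct (g h : UniGroup n K) (lam : DualNil n K) :
    leftAct g (rightAct lam h) = rightAct (leftAct g lam) h :=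
  LinearMap.ext fun X => congrArg lam (Subtype.ext (by simp [mulLeftMap, mulRightMap, mul_assoc]))

theorem rightAct_injective (h : UniGroup n K) :
    Function.Injective fun lam : DualNil n K => rightAct lam h := by
  intro lam mu e
  have := congrArg (fun nu => rightAct nu h⁻¹) e
  simpa only [rightAct_rightAct, mul_inv_cancel, rightAct_one] using this

theorem mem_leftOrbit_self (lam : DualNil n K) : lam ∈ leftOrbit lam := ⟨1, (leftAct_one lam).symm⟩

theorem leftAct_mem_leftOrbit {lam mu : DualNil n K} (g : UniGroup n K) (h : mu ∈ leftOrbit lam) :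
    leftAct g mu ∈ leftOrbit lam := by
  obtain ⟨k, rfl⟩ := h
  exact ⟨g * k, leftAct_leftAct _ _ _⟩

theorem leftOrbit_leftAct (g : UniGroup n K) (lam : DualNil n K) :
    leftOrbit (leftAct g lam) = leftOrbit lam := by
  ext mu
  constructor
  · rintro ⟨k, rfl⟩
    exact leftAct_mem_leftOrbit k ⟨g, rfl⟩
  · rintro ⟨k, rfl⟩
    exact ⟨k * g⁻¹, by rw [leftAct_leftAct, inv_mul_cancel_right]⟩

theorem leftOrbit_rightAct (h : UniGroup n K) (lam : DualNil n K) :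
    leftOrbit (rightAct lam h) = (fun mu => rightAct mu h) '' leftOrbit lam := by
  ext mu
  constructor
  · rintro ⟨k, rfl⟩
    exact ⟨leftAct k lam, ⟨k, rfl⟩, (leftAct_rightAct _ _ _).symm⟩
  · rintro ⟨_, ⟨k, rfl⟩, rfl⟩
    exact ⟨k, (leftAct_rightAct _ _ _).symm⟩

/-- On the stabilizer of `mu` under the left action, right translates of `mu` take the same values
at `g - I`: the difference `mu(h(g - I)) - mu(g - I)` is `(g * mu - mu)(h - I)`. -/
theorem rightAct_subOne {g : UniGroup n K} {mu : DualNil n K} (hg : leftAct g mu = mu)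
    (h : UniGroup n K) : rightAct mu h (subOne g) = mu (subOne g) := by
  have e : mulLeftMap h (subOne g) = subOne g + (mulRightMap g (subOne h) - subOne h) :=
    Subtype.ext (by simp [mulLeftMap, mulRightMap, subOne]; noncomm_ring)
  have e' : mu (mulRightMap g (subOne h)) = mu (subOne h) := LinearMap.congr_fun hg _
  change mu (mulLeftMap h (subOne g)) = _
  rw [e, map_add, map_sub, e', sub_self, add_zero]

theorem mem_coadjointCluster_self (lam : DualNil n K) : lam ∈ coadjointCluster lam :=
  ⟨1, 1, by rw [leftAct_one, rightAct_one]⟩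

theorem coadjointCluster_smul (a : K) (lam : DualNil n K) :
    coadjointCluster (a • lam) = (fun mu => a • mu) '' coadjointCluster lam := by
  ext mu
  constructor
  · rintro ⟨g, h, rfl⟩
    exact ⟨_, ⟨g, h, rfl⟩, rfl⟩
  · rintro ⟨_, ⟨g, h, rfl⟩, rfl⟩
    exact ⟨g, h, rfl⟩

end Coordinates

/-! ### The character formula -/

section CharacterFormula

variable {n : ℕ} {F : Type*} [Field F]

instance instFiniteDualNil [Finite F] : Finite (DualNil n F) :=
  Finite.of_injective _ (DFunLike.coe_injective (F := NilMat n F →ₗ[F] F))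

theorem exists_apply_mul_ne_one {θ : AddChar F ℂ} (hθ : θ ≠ 1) {c : F} (hc : c ≠ 0) :
    ∃ t, θ (t * c) ≠ 1 := by
  obtain ⟨s, hs⟩ := AddChar.ne_one_iff.mp hθ
  exact ⟨s / c, by rwa [div_mul_cancel₀ _ hc]⟩

theorem compAddMonoidHom_dual_injective {θ : AddChar F ℂ} (hθ : θ ≠ 1) :
    Function.Injective fun lam : DualNil n F => θ.compAddMonoidHom lam.toAddMonoidHom := by
  intro lam mu e
  by_contra hne
  obtain ⟨X, hX⟩ : ∃ X, (lam - mu) X ≠ 0 := by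
    by_contra! h
    exact hne (sub_eq_zero.mp (LinearMap.ext h))
  obtain ⟨t, ht⟩ := exists_apply_mul_ne_one hθ hX
  refine ht ?_
  have e' : θ (lam (t • X)) = θ (mu (t • X)) := DFunLike.congr_fun e (t • X)
  rw [← smul_eq_mul, ← map_smul, LinearMap.sub_apply, AddChar.map_sub_eq_div, e',
    div_self (θ.val_isUnit _).ne_zero]

theorem linearIndependent_fourier [Finite F] {θ : AddChar F ℂ} (hθ : θ ≠ 1) :
    LinearIndependent ℂ (fourier θ : DualNil n F → UniGroup n F → ℂ) := by
  have h := (AddChar.linearIndependent (NilMat n F) ℂ).comp _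
    (compAddMonoidHom_dual_injective (n := n) hθ)
  exact h.map' (LinearMap.funLeft ℂ ℂ subOne)
    (LinearMap.ker_eq_bot.mpr (LinearMap.funLeft_injective_of_surjective ℂ ℂ _ subOne_surjective))

theorem fourier_mem_clusterModule (θ : AddChar F ℂ) {lam mu : DualNil n F}
    (h : mu ∈ leftOrbit lam) : fourier θ mu ∈ (clusterModule θ lam).toSubmodule :=
  Submodule.subset_span ⟨mu, h, rfl⟩

/-- The basis of the cluster module `V(lam)` formed by the functions `v(mu)`, where `mu` runs
through the left orbit of `lam`. -/
def clusterBasis [Finite F] {θ : AddChar F ℂ} (hθ : θ ≠ 1) (lam : DualNil n F) :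
    Module.Basis (leftOrbit lam) ℂ (clusterModule θ lam).toSubmodule :=
  Module.Basis.mk
    (v := fun mu : leftOrbit lam => (⟨fourier θ mu, fourier_mem_clusterModule θ mu.2⟩ :
      (clusterModule θ lam).toSubmodule))
    (LinearIndependent.of_comp (clusterModule θ lam).toSubmodule.subtype
      ((linearIndependent_fourier hθ).comp _ Subtype.val_injective))
    (by
      rintro ⟨x, hx⟩ -
      obtain ⟨y, hy, rfl⟩ : x ∈ (Submodule.span ℂ (Set.range fun mu : leftOrbit lam =>
          (⟨fourier θ mu, fourier_mem_clusterModule θ mu.2⟩ :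
            (clusterModule θ lam).toSubmodule))).map (clusterModule θ lam).toSubmodule.subtype := by
        rw [Submodule.map_span]
        refine Submodule.span_mono ?_ hx
        rintro _ ⟨mu, hmu, rfl⟩
        exact ⟨_, ⟨⟨mu, hmu⟩, rfl⟩, rfl⟩
      exact hy)

theorem clusterRep_clusterBasis [Finite F] {θ : AddChar F ℂ} (hθ : θ ≠ 1) (lam : DualNil n F)
    (g : UniGroup n F) (mu : leftOrbit lam) :
    clusterRep θ lam g (clusterBasis hθ lam mu) = θ (mu.1 (subOne g)) •
      clusterBasis hθ lam ⟨leftAct g mu, leftAct_mem_leftOrbit g mu.2⟩ := by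
  simp only [clusterBasis, Module.Basis.mk_apply]
  exact Subtype.ext (regularRep_fourier θ mu.1 g)

/-- The contribution of the basis vector `v(mu)` to the trace of `g` on a cluster module. -/
def diagEntry (θ : AddChar F ℂ) (g : UniGroup n F) (mu : DualNil n F) : ℂ :=
  open scoped Classical in if leftAct g mu = mu then θ (mu (subOne g)) else 0

/-- The group permutes the lines spanned by the basis vectors `v(mu)`, so that the trace of `g` is
a sum over the `mu` in the left orbit that `g` fixes. -/
theorem clusterCharacter_apply [Finite F] {θ : AddChar F ℂ} (hθ : θ ≠ 1) (lam : DualNil n F)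
    (g : UniGroup n F) :
    clusterCharacter θ lam g = ∑ mu ∈ (leftOrbit lam).toFinite.toFinset, diagEntry θ g mu := by
  classical
  let := Fintype.ofFinite (leftOrbit lam)
  rw [clusterCharacter, Representation.character,
    LinearMap.trace_eq_matrix_trace ℂ (clusterBasis hθ lam), Matrix.trace,
    Finset.sum_subtype _ (fun mu => Set.Finite.mem_toFinset _)]
  refine Finset.sum_congr rfl fun mu _ => ?_
  rw [Matrix.diag_apply, LinearMap.toMatrix_apply, clusterRep_clusterBasis, map_smul,
    Module.Basis.repr_self, Finsupp.smul_apply, Finsupp.single_apply, diagEntry]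
  simp only [Subtype.ext_iff, smul_eq_mul, mul_ite, mul_one, mul_zero]

theorem diagEntry_rightAct (θ : AddChar F ℂ) (g h : UniGroup n F) (mu : DualNil n F) :
    diagEntry θ g (rightAct mu h) = diagEntry θ g mu := by
  rw [diagEntry, diagEntry, leftAct_rightAct]
  by_cases hg : leftAct g mu = mu
  · rw [if_pos hg, if_pos (by rw [hg]), rightAct_subOne hg]
  · rw [if_neg hg, if_neg fun e => hg (rightAct_injective h e)]

theorem clusterCharacter_rightAct [Finite F] {θ : AddChar F ℂ} (hθ : θ ≠ 1) (lam : DualNil n F)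
    (h : UniGroup n F) : clusterCharacter θ (rightAct lam h) = clusterCharacter θ lam := by
  funext g
  rw [clusterCharacter_apply hθ, clusterCharacter_apply hθ]
  symm
  refine Finset.sum_nbij (fun mu => rightAct mu h) ?_ (rightAct_injective h).injOn ?_ ?_
  · intro mu hmu
    rw [Set.Finite.mem_toFinset, leftOrbit_rightAct] at *
    exact ⟨mu, hmu, rfl⟩
  · intro mu hmu
    rw [Set.Finite.coe_toFinset, leftOrbit_rightAct] at *
    exact hmu
  · intro mu _
    exact (diagEntry_rightAct θ g h mu).symm

theorem clusterCharacter_of_mem_coadjointCluster [Finite F] {θ : AddChar F ℂ} (hθ : θ ≠ 1)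
    {lam mu : DualNil n F} (h : mu ∈ coadjointCluster lam) :
    clusterCharacter θ mu = clusterCharacter θ lam := by
  obtain ⟨g, g', rfl⟩ := h
  rw [clusterCharacter_rightAct hθ]
  funext k
  rw [clusterCharacter_apply hθ, clusterCharacter_apply hθ]
  simp only [leftOrbit_leftAct]

end CharacterFormula

/-! ### The character of a tensor product -/

section TensorCharacter

/-- The trace of a tensor product of endomorphisms is the product of the traces: in the basis of
pure tensors of basis vectors, the diagonal entries are products of diagonal entries. -/
theorem trace_piTensorProduct_map {R ι : Type*} [CommRing R] [Fintype ι] {V : ι → Type*}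
    {κ : ι → Type*} [∀ k, Finite (κ k)] [∀ k, AddCommGroup (V k)] [∀ k, Module R (V k)]
    (b : ∀ k, Module.Basis (κ k) R (V k)) (f : ∀ k, V k →ₗ[R] V k) :
    LinearMap.trace R _ (PiTensorProduct.map f) = ∏ k, LinearMap.trace R _ (f k) := by
  classical
  let := fun k => Fintype.ofFinite (κ k)
  rw [LinearMap.trace_eq_matrix_trace R (Basis.piTensorProduct b), Matrix.trace]
  simp only [fun k => LinearMap.trace_eq_matrix_trace R (b k) (f k), Matrix.trace,
    Matrix.diag_apply, LinearMap.toMatrix_apply, Basis.piTensorProduct_apply,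
    PiTensorProduct.map_tprod, Basis.piTensorProduct_repr_tprod_apply]
  rw [Finset.prod_univ_sum, Fintype.piFinset_univ]

theorem tensorRep_clusterRep_character {n m : ℕ} {F : Type*} [Field F] [Finite F]
    {θ : AddChar F ℂ} (hθ : θ ≠ 1) : ∀ mu : Fin m → DualNil n F,
    (tensorRep fun k => clusterRep θ (mu k)).character = ∏ k, clusterCharacter θ (mu k) := by
  intro mu
  funext g
  rw [Finset.prod_apply]
  exact trace_piTensorProduct_map (fun k => clusterBasis hθ (mu k)) fun k => clusterRep θ (mu k) g

end TensorCharacter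

/-! ### Factorization of the characters of coadjoint templates -/

section Templates

variable {n : ℕ} {K : Type*} [Field K]

theorem coeff_leftAct_smul_dualElem (g : UniGroup n K) (a : K) (p : Pos n) {i l : Fin n}
    (h : i < l) : coeff (leftAct g (a • dualElem K p)) i l =
      if i = p.1.1 then toMat g l p.1.2 * a else 0 := by
  rw [coeff_leftAct g _ h]
  simp only [coeff_smul_dualElem]
  by_cases hi : i = p.1.1 <;> simp [hi]

/-- The left action only involves column operations, so that it does not leave a row. -/
theorem coeff_eq_zero_of_mem_leftOrbit {a : K} {p : Pos n} {mu : DualNil n K}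
    (hmu : mu ∈ leftOrbit (a • dualElem K p)) {i : Fin n} (hi : i ≠ p.1.1) (l : Fin n) :
    coeff mu i l = 0 := by
  obtain ⟨g, rfl⟩ := hmu
  rcases lt_or_ge i l with h | h
  · rw [coeff_leftAct_smul_dualElem g a p h, if_neg hi]
  · exact coeff_of_le _ h

theorem eq_zero_of_mem_leftOrbit_zero {mu : DualNil n K}
    (hmu : mu ∈ leftOrbit (0 : DualNil n K)) : mu = 0 := by
  obtain ⟨g, rfl⟩ := hmu
  rfl

/-- Since the positions in the support of a template lie in different columns, one element of
`U(n, K)` can act on all its entries in independently prescribed ways. -/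
theorem exists_leftAct_eq {τ : DualNil n K} (hτ : IsCoadjointTemplate τ)
    (g : Pos n → UniGroup n K) : ∃ h : UniGroup n K, ∀ p,
      leftAct h (τ (elemMat K p) • dualElem K p) =
        leftAct (g p) (τ (elemMat K p) • dualElem K p) := by
  classical
  -- The column `j` of `h` is that of `g p`, where `p` is the position of the support in column `j`.
  let Y : NilMat n K := ⟨fun l j => if hj : ∃ p ∈ supp τ, p.1.2 = j then
    (subOne (g hj.choose) : Matrix (Fin n) (Fin n) K) l j else 0, by
      intro i j hij
      dsimp only
      split_ifs with hj
      · exact (subOne (g hj.choose)).2 i j hij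
      · rfl⟩
  refine ⟨ofNil Y, fun p => ?_⟩
  by_cases hp : p ∈ supp τ
  · refine ext_coeff fun i l hil => ?_
    rw [coeff_leftAct_smul_dualElem _ _ _ hil, coeff_leftAct_smul_dualElem _ _ _ hil]
    have hj : ∃ q ∈ supp τ, q.1.2 = p.1.2 := ⟨p, hp, rfl⟩
    have hq : hj.choose = p := hτ.2 _ hj.choose_spec.1 _ hp hj.choose_spec.2
    have hY : (Y : Matrix (Fin n) (Fin n) K) l p.1.2
        = (subOne (g p) : Matrix (Fin n) (Fin n) K) l p.1.2 := by
      change (if hj : ∃ q ∈ supp τ, q.1.2 = p.1.2 then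
        (subOne (g hj.choose) : Matrix (Fin n) (Fin n) K) l p.1.2 else 0) = _
      rw [dif_pos hj, hq]
    rw [toMat_eq_one_add, toMat_eq_one_add, subOne_ofNil, Matrix.add_apply, Matrix.add_apply, hY]
  · rw [not_not.mp hp, zero_smul]
    rfl

/-- Since the positions in the support of a template lie in different rows, an element of its left
orbit determines its components in the left orbits of the entries. -/
theorem eq_of_sum_eq {τ : DualNil n K} (hτ : IsCoadjointTemplate τ) {mu nu : Pos n → DualNil n K}
    (hmu : ∀ p, mu p ∈ leftOrbit (τ (elemMat K p) • dualElem K p))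
    (hnu : ∀ p, nu p ∈ leftOrbit (τ (elemMat K p) • dualElem K p))
    (h : ∑ p, mu p = ∑ p, nu p) : mu = nu := by
  have zero {ka : Pos n → DualNil n K}
      (hka : ∀ p, ka p ∈ leftOrbit (τ (elemMat K p) • dualElem K p)) {q : Pos n}
      (hq : q ∉ supp τ) : ka q = 0 := by
    have := hka q
    rw [not_not.mp hq, zero_smul] at this
    exact eq_zero_of_mem_leftOrbit_zero this
  have key {ka : Pos n → DualNil n K}
      (hka : ∀ p, ka p ∈ leftOrbit (τ (elemMat K p) • dualElem K p)) {p : Pos n}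
      (hp : p ∈ supp τ) (l : Fin n) : coeff (ka p) p.1.1 l = coeff (∑ q, ka q) p.1.1 l := by
    rw [coeff_sum, Finset.sum_eq_single p]
    · intro q _ hqp
      by_cases hq : q ∈ supp τ
      · exact coeff_eq_zero_of_mem_leftOrbit (hka q) (fun e => hqp (hτ.1 _ hq _ hp e.symm)) l
      · rw [zero hka hq]
        simp [coeff]
    · simp
  funext p
  by_cases hp : p ∈ supp τ
  · refine ext_coeff fun i l _ => ?_
    by_cases hi : i = p.1.1
    · rw [hi, key hmu hp, key hnu hp, h]
    · rw [coeff_eq_zero_of_mem_leftOrbit (hmu p) hi, coeff_eq_zero_of_mem_leftOrbit (hnu p) hi]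
  · rw [zero hmu hp, zero hnu hp]

end Templates

section TemplateCharacter

variable {n : ℕ} {F : Type*} [Field F]

theorem addChar_map_sum {ι : Type*} (θ : AddChar F ℂ) (s : Finset ι) (f : ι → F) :
    θ (∑ i ∈ s, f i) = ∏ i ∈ s, θ (f i) := by
  classical
  induction s using Finset.induction_on with
  | empty => simp
  | insert i s hi ih =>
    rw [Finset.sum_insert hi, Finset.prod_insert hi, AddChar.map_add_eq_mul, ih]

theorem diagEntry_sum {τ : DualNil n F} (hτ : IsCoadjointTemplate τ) (θ : AddChar F ℂ)
    (g : UniGroup n F) {mu : Pos n → DualNil n F}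
    (hmu : ∀ p, mu p ∈ leftOrbit (τ (elemMat F p) • dualElem F p)) :
    diagEntry θ g (∑ p, mu p) = ∏ p, diagEntry θ g (mu p) := by
  classical
  have hfix : leftAct g (∑ p, mu p) = ∑ p, mu p ↔ ∀ p, leftAct g (mu p) = mu p := by
    rw [leftAct_sum]
    refine ⟨fun h p => ?_, fun h => Finset.sum_congr rfl fun p _ => h p⟩
    exact congrFun (eq_of_sum_eq hτ (fun p => leftAct_mem_leftOrbit g (hmu p)) hmu h) p
  simp only [diagEntry]
  rw [Fintype.prod_ite_zero]
  simp only [hfix, LinearMap.sum_apply, addChar_map_sum]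

/-- The left orbit of a template is the direct sum of the left orbits of its entries, compatibly
with the action, so that its character is the product of the characters of the entries. -/
theorem clusterCharacter_template [Finite F] {θ : AddChar F ℂ} (hθ : θ ≠ 1) {τ : DualNil n F}
    (hτ : IsCoadjointTemplate τ) :
    clusterCharacter θ τ = ∏ p : Pos n, clusterCharacter θ (τ (elemMat F p) • dualElem F p) := by
  classical
  funext g
  simp only [Finset.prod_apply, clusterCharacter_apply hθ]
  rw [Finset.prod_univ_sum]
  have mem {mu : Pos n → DualNil n F} : mu ∈ Fintype.piFinset (fun p : Pos n =>
      (leftOrbit (τ (elemMat F p) • dualElem F p)).toFinite.toFinset) ↔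
      ∀ p, mu p ∈ leftOrbit (τ (elemMat F p) • dualElem F p) := by
    simp only [Fintype.mem_piFinset, Set.Finite.mem_toFinset]
  symm
  refine Finset.sum_nbij (fun mu => ∑ p, mu p) ?_ ?_ ?_ ?_
  · intro mu hmu
    rw [mem] at hmu
    choose h hh using hmu
    obtain ⟨k, hk⟩ := exists_leftAct_eq hτ h
    rw [Set.Finite.mem_toFinset]
    refine ⟨k, ?_⟩
    conv_rhs => rw [← sum_smul_dualElem τ, leftAct_sum]
    exact Finset.sum_congr rfl fun p _ => by rw [hh, hk]
  · intro mu hmu nu hnu h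
    exact eq_of_sum_eq hτ (mem.mp hmu) (mem.mp hnu) h
  · intro mu hmu
    obtain ⟨k, rfl⟩ := (Set.Finite.mem_toFinset _).mp hmu
    refine ⟨fun p => leftAct k (τ (elemMat F p) • dualElem F p), mem.mpr fun p => ⟨k, rfl⟩, ?_⟩
    dsimp only
    rw [← leftAct_sum, sum_smul_dualElem]
  · intro mu hmu
    exact (diagEntry_sum hτ θ g (mem.mp hmu)).symm

end TemplateCharacter

/-! ### Reduction to coadjoint templates -/

section Reduction

variable {n : ℕ} {K : Type*} [Field K]

theorem mem_coadjointCluster_trans {lam mu nu : DualNil n K} (h : nu ∈ coadjointCluster mu)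
    (h' : mu ∈ coadjointCluster lam) : nu ∈ coadjointCluster lam := by
  obtain ⟨g', k', rfl⟩ := h'
  obtain ⟨g, k, rfl⟩ := h
  exact ⟨g * g', k' * k, by rw [leftAct_rightAct, rightAct_rightAct, leftAct_leftAct]⟩

/-- Multiples of a column can be added to the columns to its left. -/
theorem exists_coeff_leftAct_eq (j : Fin n) (c : Fin n → K) : ∃ g : UniGroup n K,
    ∀ (mu : DualNil n K) (i l : Fin n), i < l → coeff (leftAct g mu) i l =
      coeff mu i l + if l < j then c l * coeff mu i j else 0 := by
  let X : NilMat n K := ⟨Matrix.of fun l m => if l < j ∧ m = j then c l else 0, fun l m hml =>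
    if_neg fun (h : l < j ∧ m = j) => absurd hml (not_le.mpr (h.2 ▸ h.1))⟩
  refine ⟨ofNil X, fun mu i l h => ?_⟩
  rw [coeff_leftAct _ _ h, toMat_ofNil]
  simp only [Matrix.add_apply, add_mul, Finset.sum_add_distrib, Matrix.one_apply, ite_mul, one_mul,
    zero_mul, Finset.sum_ite_eq, Finset.mem_univ, if_true, Matrix.of_apply, X]
  congr 1
  by_cases hl : l < j <;> simp [hl]

/-- Multiples of a row can be added to the rows below it. -/
theorem exists_coeff_rightAct_eq (r : Fin n) (d : Fin n → K) : ∃ g : UniGroup n K,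
    ∀ (mu : DualNil n K) (i l : Fin n), i < l → coeff (rightAct mu g) i l =
      coeff mu i l + if r < i then d i * coeff mu r l else 0 := by
  let X : NilMat n K := ⟨Matrix.of fun k i => if k = r ∧ r < i then d i else 0, fun k i hik =>
    if_neg fun (h : k = r ∧ r < i) => absurd hik (not_le.mpr (h.1.symm ▸ h.2))⟩
  refine ⟨ofNil X, fun mu i l h => ?_⟩
  rw [coeff_rightAct _ _ h, toMat_ofNil]
  simp only [Matrix.add_apply, add_mul, Finset.sum_add_distrib, Matrix.one_apply, ite_mul, one_mul,
    zero_mul, Finset.sum_ite_eq', Finset.mem_univ, if_true, Matrix.of_apply, X]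
  congr 1
  by_cases hl : r < i <;> simp [hl]

/-- The template condition for the first `r` rows: a non-zero entry in one of these rows is the
only non-zero entry in its row and in its entire column. -/
def IsTemplateUpTo (r : ℕ) (mu : DualNil n K) : Prop :=
  ∀ i j : Fin n, (i : ℕ) < r → coeff mu i j ≠ 0 →
    (∀ l, coeff mu i l ≠ 0 → l = j) ∧ ∀ k, coeff mu k j ≠ 0 → k = i

/-- One step of the elimination: the rightmost non-zero entry of the row `r` is used to clear first
the rest of its row, which is to its left, and then the part of its column below it. -/
theorem IsTemplateUpTo.exists_succ (r : Fin n) {mu : DualNil n K} (h : IsTemplateUpTo r mu) :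
    ∃ nu ∈ coadjointCluster mu, IsTemplateUpTo (r + 1) nu := by
  by_cases hr : ∀ j, coeff mu r j = 0
  · refine ⟨mu, mem_coadjointCluster_self mu, fun i j hi hij => ?_⟩
    rcases Nat.lt_succ_iff_lt_or_eq.mp hi with hi | hi
    · exact h i j hi hij
    · rw [Fin.ext hi, hr j] at hij
      exact absurd rfl hij
  push Not at hr
  obtain ⟨j, hj, hmax⟩ := Set.exists_max_image {j | coeff mu r j ≠ 0} id (Set.toFinite _) hr
  replace hj : coeff mu r j ≠ 0 := hj
  replace hmax : ∀ l, j < l → coeff mu r l = 0 := fun l hl => by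
    by_contra hne
    exact absurd (hmax l hne) (not_le.mpr hl)
  obtain ⟨g, hg⟩ := exists_coeff_leftAct_eq j fun l => -(coeff mu r l / coeff mu r j)
  obtain ⟨k, hk⟩ := exists_coeff_rightAct_eq r fun i =>
    -(coeff (leftAct g mu) i j / coeff (leftAct g mu) r j)
  replace hg := hg mu
  set mu' := leftAct g mu with hmu'
  replace hk := hk mu'
  set nu := rightAct mu' k with hnu
  have hrj : r < j := by
    by_contra hle
    exact hj (coeff_of_le _ (not_lt.mp hle))
  -- The entry at `(r, j)` survives; the other entries of its row and column vanish.
  have h1 : coeff mu' r j ≠ 0 := by simpa [hg r j hrj] using hj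
  have h2 : ∀ l, l ≠ j → coeff mu' r l = 0 := by
    intro l hl
    rcases lt_or_ge r l with hrl | hrl
    · rw [hg r l hrl]
      rcases lt_or_gt_of_ne hl with hlj | hlj
      · rw [if_pos hlj]; field_simp; ring
      · rw [if_neg hlj.not_gt, hmax l hlj, add_zero]
    · exact coeff_of_le _ hrl
  have h3 : ∀ i, i < r → coeff mu i j = 0 := by
    intro i hi
    by_contra hne
    exact hi.ne ((h i j hi hne).2 r hj).symm
  have h4 : ∀ l, l ≠ j → coeff nu r l = 0 := by
    intro l hl
    rcases lt_or_ge r l with hrl | hrl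
    · rw [hk r l hrl, h2 l hl, if_neg (lt_irrefl r), add_zero]
    · exact coeff_of_le _ hrl
  have h5 : ∀ i, i < r → ∀ l, coeff nu i l = coeff mu i l := by
    intro i hi l
    rcases lt_or_ge i l with hil | hil
    · rw [hk i l hil, if_neg hi.not_gt, add_zero, hg i l hil, h3 i hi, mul_zero, ite_self, add_zero]
    · rw [coeff_of_le _ hil, coeff_of_le _ hil]
  have h6 : ∀ i, i ≠ r → coeff nu i j = 0 := by
    intro i hi
    rcases lt_or_gt_of_ne hi with hir | hir
    · rw [h5 i hir, h3 i hir]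
    · rcases lt_or_ge i j with hij | hij
      · rw [hk i j hij, if_pos hir]; field_simp; ring
      · exact coeff_of_le _ hij
  have h7 : ∀ i, r < i → ∀ l, l ≠ j → coeff mu r l = 0 → coeff nu i l = coeff mu i l := by
    intro i hi l hl hrl
    rcases lt_or_ge i l with hil | hil
    · rw [hk i l hil, h2 l hl, mul_zero, ite_self, add_zero, hg i l hil, hrl, zero_div, neg_zero,
        zero_mul, ite_self, add_zero]
    · rw [coeff_of_le _ hil, coeff_of_le _ hil]
  refine ⟨nu, ⟨g, k, rfl⟩, fun i l hi hil => ?_⟩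
  rcases Nat.lt_succ_iff_lt_or_eq.mp hi with hi | hi
  · have hi' : i < r := hi
    rw [h5 i hi'] at hil
    have hlj : l ≠ j := by
      rintro rfl
      exact hil (h3 i hi')
    refine ⟨fun m hm => (h i l hi hil).1 m (by rwa [h5 i hi'] at hm), fun m hm => ?_⟩
    refine (h i l hi hil).2 m ?_
    rcases lt_trichotomy m r with hmr | rfl | hmr
    · rwa [h5 m hmr] at hm
    · exact absurd (h4 l hlj) hm
    · rwa [h7 m hmr l hlj] at hm
      by_contra hne
      exact hi'.ne ((h i l hi hil).2 r hne).symm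
  · obtain rfl := Fin.ext hi
    have hlj : l = j := by
      by_contra hne
      exact hil (h4 l hne)
    subst hlj
    exact ⟨fun m hm => by_contra fun hne => hm (h4 m hne),
      fun m hm => by_contra fun hne => hm (h6 m hne)⟩

theorem exists_template (lam : DualNil n K) :
    ∃ τ ∈ coadjointCluster lam, IsCoadjointTemplate τ := by
  have key : ∀ r ≤ n, ∃ mu ∈ coadjointCluster lam, IsTemplateUpTo r mu := by
    intro r
    induction r with
    | zero => exact fun _ => ⟨lam, mem_coadjointCluster_self lam, fun i j hi => absurd hi (by simp)⟩
    | succ r ih =>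
      intro hr
      obtain ⟨mu, hmu, h⟩ := ih (Nat.le_of_succ_le hr)
      obtain ⟨nu, hnu, h'⟩ := IsTemplateUpTo.exists_succ ⟨r, hr⟩ h
      exact ⟨nu, mem_coadjointCluster_trans hnu hmu, h'⟩
  obtain ⟨τ, hτ, h⟩ := key n le_rfl
  have hc : ∀ p ∈ supp τ, coeff τ p.1.1 p.1.2 ≠ 0 := fun p hp => by rwa [coeff_of_lt _ p.2]
  refine ⟨τ, hτ, fun p hp q hq e => ?_, fun p hp q hq e => ?_⟩
  · have := (h _ _ p.1.1.2 (hc p hp)).1 q.1.2 (by rw [e]; exact hc q hq)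
    exact Subtype.ext (Prod.ext e this.symm)
  · have := (h _ _ p.1.1.2 (hc p hp)).2 q.1.1 (by rw [e]; exact hc q hq)
    exact Subtype.ext (Prod.ext this.symm e)

end Reduction

section Factorization

variable {n : ℕ} {F : Type*} [Field F]

theorem isPrimaryCluster_smul_dualElem {a : F} (ha : a ≠ 0) (p : Pos n) :
    IsPrimaryCluster (coadjointCluster (a • dualElem F p)) :=
  ⟨p, a, ha, coadjointCluster_smul _ _⟩

theorem clusterCharacter_zero [Finite F] {θ : AddChar F ℂ} (hθ : θ ≠ 1) :
    clusterCharacter θ (0 : DualNil n F) = 1 := by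
  have e : leftOrbit (0 : DualNil n F) = {0} :=
    Set.Subset.antisymm (fun _ h => eq_zero_of_mem_leftOrbit_zero h)
      (Set.singleton_subset_iff.mpr (mem_leftOrbit_self 0))
  funext g
  rw [clusterCharacter_apply hθ, Finset.sum_eq_single 0]
  · rw [diagEntry, if_pos (by rfl)]
    simp
  · intro mu hmu h
    rw [Set.Finite.mem_toFinset, e] at hmu
    exact absurd hmu h
  · intro h
    exact absurd ((Set.Finite.mem_toFinset _).mpr (mem_leftOrbit_self 0)) h

theorem exists_primary_factorization [Finite F] {θ : AddChar F ℂ} (hθ : θ ≠ 1) (lam : DualNil n F) :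
    ∃ (m : ℕ) (mu : Fin m → DualNil n F), (∀ k, IsPrimaryCluster (coadjointCluster (mu k))) ∧
      clusterCharacter θ lam = ∏ k, clusterCharacter θ (mu k) := by
  classical
  obtain ⟨τ, hmem, hτ⟩ := exists_template lam
  let s : Finset (Pos n) := {p | τ (elemMat F p) ≠ 0}
  refine ⟨s.card, fun k => τ (elemMat F (s.equivFin.symm k)) • dualElem F (s.equivFin.symm k),
    fun k => isPrimaryCluster_smul_dualElem
      (Finset.mem_filter.mp (s.equivFin.symm k).2).2 _, ?_⟩
  rw [← clusterCharacter_of_mem_coadjointCluster hθ hmem, clusterCharacter_template hθ hτ,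
    Equiv.prod_comp s.equivFin.symm fun p =>
      clusterCharacter θ (τ (elemMat F p.1) • dualElem F p.1),
    Finset.prod_coe_sort s fun p => clusterCharacter θ (τ (elemMat F p) • dualElem F p)]
  refine (Finset.prod_subset (Finset.subset_univ s) fun p _ hp => ?_).symm
  have h0 : τ (elemMat F p) = 0 := by simpa [s] using hp
  rw [h0, zero_smul, clusterCharacter_zero hθ]

end Factorization

/-! ### Irreducibility of the primary cluster modules -/

section Irreducibility

/-- If vectors are simultaneous eigenvectors of some endomorphisms with pairwise distinct systems
of eigenvalues, then an invariant subspace that contains a non-trivial combination of them contains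
one of them: subtracting a multiple of an image shortens the combination. -/
theorem exists_mem_of_sum_mem {k V ι G : Type*} [Field k] [AddCommGroup V] [Module k V]
    (W : Submodule k V) (f : G → V →ₗ[k] V) (hW : ∀ g, ∀ w ∈ W, f g w ∈ W) (v : ι → V)
    (χ : G → ι → k) (hv : ∀ g i, f g (v i) = χ g i • v i)
    (hχ : ∀ i j, i ≠ j → ∃ g, χ g i ≠ χ g j) (S : Finset ι) (hS : S.Nonempty) (c : ι → k)
    (hc : ∀ i ∈ S, c i ≠ 0) (hmem : ∑ i ∈ S, c i • v i ∈ W) : ∃ i, v i ∈ W := by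
  classical
  induction S using Finset.strongInduction generalizing c with
  | H S ih =>
    obtain ⟨i, hi⟩ := hS
    by_cases hone : ∀ j ∈ S, j = i
    · have hSi : S = {i} := Finset.eq_singleton_iff_unique_mem.mpr ⟨hi, hone⟩
      rw [hSi, Finset.sum_singleton] at hmem
      exact ⟨i, (W.smul_mem_iff (hc i hi)).mp hmem⟩
    · push Not at hone
      obtain ⟨j, hj, hji⟩ := hone
      obtain ⟨g, hg⟩ := hχ j i hji
      have hsub := W.sub_mem (hW g _ hmem) (W.smul_mem (χ g i) hmem)
      have e : f g (∑ l ∈ S, c l • v l) - χ g i • ∑ l ∈ S, c l • v l =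
          ∑ l ∈ S with χ g l ≠ χ g i, (c l * (χ g l - χ g i)) • v l := by
        rw [map_sum, Finset.smul_sum, ← Finset.sum_sub_distrib, Finset.sum_filter]
        refine Finset.sum_congr rfl fun l _ => ?_
        rw [map_smul, hv, smul_smul, smul_smul, ← sub_smul]
        split_ifs with hl
        · congr 1; ring
        · rw [not_not.mp hl, mul_comm, sub_self, zero_smul]
      rw [e] at hsub
      refine ih _ ?_ ⟨j, Finset.mem_filter.mpr ⟨hj, hg⟩⟩ _ ?_ hsub
      · exact Finset.filter_ssubset.mpr ⟨i, hi, fun h => h rfl⟩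
      · intro l hl
        rw [Finset.mem_filter] at hl
        exact mul_ne_zero (hc l hl.1) (sub_ne_zero.mpr hl.2)

variable {n : ℕ} {F : Type*} [Field F]

/-- Elements of `𝔲*` supported in the row `r` are fixed by the matrices `I + t e_{rl}`. -/
theorem leftAct_ofNil_smul_elemMat {nu : DualNil n F} {p : Pos n}
    (hnu : ∀ i l, i ≠ p.1.1 → coeff nu i l = 0) (t : F) :
    leftAct (ofNil (t • elemMat F p)) nu = nu := by
  refine ext_coeff fun i l h => ?_
  rw [coeff_leftAct _ _ h, toMat_ofNil]
  simp only [Matrix.add_apply, add_mul, Finset.sum_add_distrib, Matrix.one_apply, ite_mul, one_mul,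
    zero_mul, Finset.sum_ite_eq, Finset.mem_univ, if_true, add_eq_left]
  refine Finset.sum_eq_zero fun m _ => ?_
  by_cases hi : i = p.1.1
  · have hl : p.1.1 ≠ l := hi ▸ h.ne
    simp [elemMat, hl]
  · rw [hnu i m hi, mul_zero]

/-- The elements of a primary left orbit are separated by the characters of their common
stabilizer: for `a ε_{ij}` this contains all `I + X` with `X` in the row `i`, and the right action
preserves stabilizers and the values on them. -/
theorem exists_separating {θ : AddChar F ℂ} (hθ : θ ≠ 1) {lam : DualNil n F}
    (hlam : IsPrimaryCluster (coadjointCluster lam)) {mu mu' : DualNil n F}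
    (hmu : mu ∈ leftOrbit lam) (hmu' : mu' ∈ leftOrbit lam) (hne : mu ≠ mu') :
    ∃ g : UniGroup n F, (∀ nu ∈ leftOrbit lam, leftAct g nu = nu) ∧
      θ (mu (subOne g)) ≠ θ (mu' (subOne g)) := by
  obtain ⟨p, a, -, hΨ⟩ := hlam
  have hself := mem_coadjointCluster_self lam
  rw [hΨ, ← coadjointCluster_smul] at hself
  obtain ⟨k, h, rfl⟩ := hself
  rw [leftOrbit_rightAct, leftOrbit_leftAct] at hmu hmu' ⊢
  obtain ⟨nu, hnu, rfl⟩ := hmu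
  obtain ⟨nu', hnu', rfl⟩ := hmu'
  have hfix : ∀ (ka : DualNil n F), ka ∈ leftOrbit (a • dualElem F p) → ∀ (l : Fin n)
      (hl : p.1.1 < l) (t : F), leftAct (ofNil (t • elemMat F ⟨(p.1.1, l), hl⟩)) ka = ka :=
    fun ka hka l hl t => leftAct_ofNil_smul_elemMat
      (p := ⟨(p.1.1, l), hl⟩) (fun i m hi => coeff_eq_zero_of_mem_leftOrbit hka hi m) t
  obtain ⟨l, hl, hcl⟩ : ∃ l, ∃ hl : p.1.1 < l, (nu - nu') (elemMat F ⟨(p.1.1, l), hl⟩) ≠ 0 := by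
    by_contra! hall
    refine hne (congrArg (fun ka => rightAct ka h) (ext_coeff fun i l hil => ?_))
    by_cases hi : i = p.1.1
    · subst hi
      rw [coeff_of_lt _ hil, coeff_of_lt _ hil]
      exact sub_eq_zero.mp (hall l hil)
    · rw [coeff_eq_zero_of_mem_leftOrbit hnu hi, coeff_eq_zero_of_mem_leftOrbit hnu' hi]
  obtain ⟨t, ht⟩ := exists_apply_mul_ne_one hθ hcl
  refine ⟨ofNil (t • elemMat F ⟨(p.1.1, l), hl⟩), ?_, fun e => ht ?_⟩
  · rintro _ ⟨ka, hka, rfl⟩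
    dsimp only
    rw [leftAct_rightAct, hfix ka hka]
  · dsimp only at e
    rw [rightAct_subOne (hfix nu hnu l hl t), rightAct_subOne (hfix nu' hnu' l hl t),
      subOne_ofNil] at e
    rw [← smul_eq_mul, ← map_smul, LinearMap.sub_apply, sub_eq_add_neg, AddChar.map_add_eq_mul, e,
      ← AddChar.map_add_eq_mul, add_neg_cancel, AddChar.map_zero_eq_one]

/-- A non-zero invariant subspace contains a basis vector `v(mu)`, since the common stabilizer of
the left orbit has a different character on each of these, and then all of them, since the group
permutes their lines transitively. -/
theorem isIrreducible_clusterRep [Finite F] {θ : AddChar F ℂ} (hθ : θ ≠ 1) {lam : DualNil n F}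
    (hlam : IsPrimaryCluster (coadjointCluster lam)) : (clusterRep θ lam).IsIrreducible := by
  let b := clusterBasis hθ lam
  have hb := clusterRep_clusterBasis hθ lam
  have : Nontrivial (Subrepresentation (clusterRep θ lam)) := by
    refine ⟨⊥, ⊤, fun e => b.ne_zero ⟨lam, mem_leftOrbit_self lam⟩ ?_⟩
    have h : b ⟨lam, mem_leftOrbit_self lam⟩ ∈ (⊤ : Subrepresentation (clusterRep θ lam)) :=
      Submodule.mem_top
    rw [← e] at h
    exact (Submodule.mem_bot ℂ).mp h
  refine ⟨fun σ => or_iff_not_imp_left.mpr fun hσ => ?_⟩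
  obtain ⟨w, hw, hw0⟩ := (Submodule.ne_bot_iff σ.toSubmodule).mp fun e =>
    hσ (Subrepresentation.toSubmodule_injective e)
  obtain ⟨⟨mu, h, rfl⟩, hmu⟩ : ∃ mu, b mu ∈ σ.toSubmodule := by
    refine exists_mem_of_sum_mem
      (G := {g : UniGroup n F // ∀ nu ∈ leftOrbit lam, leftAct g nu = nu}) σ.toSubmodule
      (fun g => clusterRep θ lam g) (fun g w hw => σ.apply_mem_toSubmodule g hw) b
      (fun g mu => θ (mu.1 (subOne g.1))) ?_ ?_ (b.repr w).support ?_ (b.repr w) ?_ ?_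
    · rintro ⟨g, hg⟩ mu
      rw [hb]
      congr 2
      exact Subtype.ext (hg mu mu.2)
    · intro mu mu' hne
      obtain ⟨g, hg, hsep⟩ := exists_separating hθ hlam mu.2 mu'.2 (Subtype.coe_ne_coe.mpr hne)
      exact ⟨⟨g, hg⟩, hsep⟩
    · rw [Finsupp.support_nonempty_iff]
      simpa using hw0
    · exact fun i hi => Finsupp.mem_support_iff.mp hi
    · have := b.linearCombination_repr w
      rw [Finsupp.linearCombination_apply, Finsupp.sum] at this
      rwa [this]
  refine Subrepresentation.toSubmodule_injective (top_le_iff.mp ?_)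
  change ⊤ ≤ σ.toSubmodule
  rw [← b.span_eq, Submodule.span_le]
  rintro _ ⟨⟨_, k, rfl⟩, rfl⟩
  have hk := σ.apply_mem_toSubmodule (k * h⁻¹) hmu
  rw [hb] at hk
  have hunit : θ (leftAct h lam (subOne (k * h⁻¹))) ≠ 0 := (θ.val_isUnit _).ne_zero
  rw [Submodule.smul_mem_iff _ hunit] at hk
  have e : leftAct (k * h⁻¹) (leftAct h lam) = leftAct k lam := by
    rw [leftAct_leftAct, inv_mul_cancel_right]
  simp only [e] at hk
  exact hk

end Irreducibility

end ClusterRep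

end

open ClusterRep in
/-- For every coadjoint template, the cluster character is the product over all positions `i < j`
of the characters of `τ(e_{ij}) · ε_{ij}`; every cluster character is the character of a tensor
product of finitely many cluster modules of primary coadjoint clusters; and the cluster modules of
primary coadjoint clusters are irreducible. -/
theorem theorem7p1 {F : Type*} [Field F] [Finite F] (θ : AddChar F ℂ) (hθ : θ ≠ 1) (n : ℕ) :
    (∀ τ : DualNil n F, IsCoadjointTemplate τ →
      clusterCharacter θ τ = ∏ p : Pos n, clusterCharacter θ (τ (elemMat F p) • dualElem F p)) ∧
    (∀ lam : DualNil n F, ∃ (m : ℕ) (mu : Fin m → DualNil n F),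
      (∀ k, IsPrimaryCluster (coadjointCluster (mu k))) ∧
      clusterCharacter θ lam = ∏ k, clusterCharacter θ (mu k) ∧
      clusterCharacter θ lam = (tensorRep fun k => clusterRep θ (mu k)).character) ∧
    (∀ lam : DualNil n F, IsPrimaryCluster (coadjointCluster lam) →
      (clusterRep θ lam).IsIrreducible) := by
  refine ⟨fun τ hτ => clusterCharacter_template hθ hτ, fun lam => ?_,
    fun lam hlam => isIrreducible_clusterRep hθ hlam⟩
  obtain ⟨m, mu, hprimary, hchar⟩ := exists_primary_factorization hθ lam
  exact ⟨m, mu, hprimary, hchar, by rw [hchar, tensorRep_clusterRep_character hθ mu]⟩
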